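/- Let $\Omega\subset\mathbb R^2$ be a bounded open set, $X=H^1_0(\Omega)^2$, $Q=L^2_0(\Omega)$. Let $\|\cdot\|$ and $(\cdot,\cdot)$ be the $L^2(\Omega)$ norm and inner product of scalars, vectors and tensors, let $$b^*(u,v,w)=\tfrac12(u\cdot\nabla v,w)-\tfrac12(u\cdot\nabla w,v),$$ and for a bounded linear functional $f$ on $X$, whose value at $v$ is written $(f,v)$, let $\|f\|_{-1}=\sup_{0\ne v\in X}(f,v)/\|\nabla v\|$. For every constant $C_{\rm inv}$ there is a constant $C>0$, depending only on $\Omega$ and $C_{\rm inv}$, such that the following holds. Let $h>0$, and let $X_h\subset X$, $Q_h\subset Q$ be (finite element) subspaces satisfying the inverse inequality $h\|\nabla v_h\|\le C_{\rm inv}\|v_h\|$ for all $v_h\in X_h$. Let $\nu>0$, $\Delta t>0$, $J\ge1$, $N>2$, let $f_j^n$ be bounded linear functionals on $X$, and let $u_{j,h}^n\in X_h$ $(0\le n\le N)$ and $p_{j,h}^n\in Q_h$ $(3\le n\le N)$, $j=1,\dots,J$. Write $$\langle u_h\rangle^n=\frac1J\sum_{j=1}^J\left(3u_{j,h}^n-3u_{j,h}^{n-1}+u_{j,h}^{n-2}\right),\qquad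 u_{j,h}'^{\,n}=3u_{j,h}^n-3u_{j,h}^{n-1}+u_{j,h}^{n-2}-\langle u_h\rangle^n .$$ Suppose that for all $2\le n\le N-1$ and $j=1,\dots,J$ $$\Big(\tfrac{10u_{j,h}^{n+1}-15u_{j,h}^n+6u_{j,h}^{n-1}-u_{j,h}^{n-2}}{6\Delta t},v_h\Big)+b^*(\langle u_h\rangle^n,u_{j,h}^{n+1},v_h)+b^*(u_{j,h}'^{\,n},3u_{j,h}^n-3u_{j,h}^{n-1}+u_{j,h}^{n-2},v_h)-(p_{j,h}^{n+1},\nabla\cdot v_h)+\nu(\nabla u_{j,h}^{n+1},\nabla v_h)=(f_j^{n+1},v_h)\quad\forall v_h\in X_h,$$ $$(\nabla\cdot u_{j,h}^{n+1},q_h)=0\quad\forall q_h\in Q_h,$$ and that the time-step conditions $$C\,\frac{\Delta t}{\nu h}\left(\|u_{j,h}'^{\,n}\|_{L^4}+\|\nabla\cdot u_{j,h}'^{\,n}\|\right)^2\le 1,\qquad j=1,\dots,J,\quad 2\le n\le N-1,$$ hold. Then, for every $j=1,\dots,J$, $$\frac1{12}\|u_{j,h}^N\|^2+\frac1{12}\|3u_{j,h}^N-u_{j,h}^{N-1}\|^2+\frac1{12}\|3u_{j,h}^N-3u_{j,h}^{N-1}+u_{j,h}^{N-2}\|^2+\frac1{24}\sum_{n=2}^{N-1}\|u_{j,h}^{n+1}-3u_{j,h}^n+3u_{j,h}^{n-1}-u_{j,h}^{n-2}\|^2+\frac{\Delta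 t}4\sum_{n=2}^{N-1}\nu\|\nabla u_{j,h}^{n+1}\|^2$$ $$\le\sum_{n=2}^{N-1}\frac{\Delta t}\nu\|f_j^{n+1}\|_{-1}^2+\frac1{12}\|u_{j,h}^2\|^2+\frac1{12}\|3u_{j,h}^2-u_{j,h}^1\|^2+\frac1{12}\|3u_{j,h}^2-3u_{j,h}^1+u_{j,h}^0\|^2 .$$ -/

import Mathlib

open MeasureTheory
open scoped ContDiff

noncomputable section

namespace EnsembleNS

/-- The Euclidean plane (points of the domain and values of velocity fields). -/
abbrev Plane := EuclideanSpace ℝ (Fin 2)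

/-- `2 × 2` tensors with the Frobenius norm; the entry `(i, k)` of a velocity gradient
is the derivative of the `i`-th component in the direction `k`. -/
abbrev Tensor := EuclideanSpace ℝ (Fin 2 × Fin 2)

/-- Lebesgue measure on the domain. -/
abbrev vol (Ω : Set Plane) : Measure Plane := volume.restrict Ω

/-- Scalar, vector and tensor fields of class `L²(Ω)`, with Mathlib's norm and inner product. -/
abbrev L2 (F : Type) [NormedAddCommGroup F] (Ω : Set Plane) := Lp F 2 (vol Ω)

/-- The classical gradient of a vector field. -/
def classicalGrad (φ : Plane → Plane) (x : Plane) : Tensor :=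
  WithLp.toLp 2 fun ik => fderiv ℝ φ x (EuclideanSpace.single ik.2 1) ik.1

/-- `φ` is a smooth vector field with compact support inside `Ω`. -/
structure IsTestField (Ω : Set Plane) (φ : Plane → Plane) : Prop where
  smooth : ContDiff ℝ ∞ φ
  compact : HasCompactSupport φ
  support_subset : tsupport φ ⊆ Ω

theorem IsTestField.add {Ω : Set Plane} {φ ψ : Plane → Plane} (hφ : IsTestField Ω φ)
    (hψ : IsTestField Ω ψ) : IsTestField Ω (φ + ψ) :=
  ⟨hφ.smooth.add hψ.smooth, hφ.compact.add hψ.compact,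
    (tsupport_add φ ψ).trans (Set.union_subset hφ.support_subset hψ.support_subset)⟩

theorem IsTestField.smul {Ω : Set Plane} {φ : Plane → Plane} (c : ℝ) (hφ : IsTestField Ω φ) :
    IsTestField Ω (c • φ) :=
  ⟨hφ.smooth.const_smul c, hφ.compact.smul_left (f := fun _ => c),
    (tsupport_smul_subset_right (fun _ => c) φ).trans hφ.support_subset⟩

theorem IsTestField.zero (Ω : Set Plane) : IsTestField Ω 0 :=
  ⟨contDiff_const, HasCompactSupport.zero, by simp [tsupport]⟩

theorem classicalGrad_zero : classicalGrad 0 = 0 := by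
  funext x
  ext ik
  simp [classicalGrad]

theorem classicalGrad_add {φ ψ : Plane → Plane} (hφ : ContDiff ℝ ∞ φ) (hψ : ContDiff ℝ ∞ ψ) :
    classicalGrad (φ + ψ) = classicalGrad φ + classicalGrad ψ := by
  funext x
  ext ik
  have h1 : DifferentiableAt ℝ φ x := (hφ.differentiable (by simp)) x
  have h2 : DifferentiableAt ℝ ψ x := (hψ.differentiable (by simp)) x
  simp [classicalGrad, fderiv_add h1 h2]

theorem classicalGrad_smul {φ : Plane → Plane} (c : ℝ) (hφ : ContDiff ℝ ∞ φ) :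
    classicalGrad (c • φ) = c • classicalGrad φ := by
  funext x
  ext ik
  have h1 : DifferentiableAt ℝ φ x := (hφ.differentiable (by simp)) x
  simp [classicalGrad, fderiv_const_smul h1 c]

/-- The pairs `(φ, ∇φ)`, as elements of `L²(Ω)² × L²(Ω)^{2×2}`, with `φ` a test field. -/
def testGraph (Ω : Set Plane) : Submodule ℝ (L2 Plane Ω × L2 Tensor Ω) where
  carrier := {g | ∃ φ, IsTestField Ω φ ∧ g.1 =ᵐ[vol Ω] φ ∧ g.2 =ᵐ[vol Ω] classicalGrad φ}
  zero_mem' := by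
    refine ⟨0, IsTestField.zero Ω, Lp.coeFn_zero .., ?_⟩
    rw [classicalGrad_zero]
    exact Lp.coeFn_zero ..
  add_mem' := by
    rintro a b ⟨φ, hφ, ha, ha'⟩ ⟨ψ, hψ, hb, hb'⟩
    refine ⟨φ + ψ, hφ.add hψ, (Lp.coeFn_add _ _).trans (ha.add hb), ?_⟩
    rw [classicalGrad_add hφ.smooth hψ.smooth]
    exact (Lp.coeFn_add _ _).trans (ha'.add hb')
  smul_mem' := by
    rintro c a ⟨φ, hφ, ha, ha'⟩
    refine ⟨c • φ, hφ.smul c, (Lp.coeFn_smul _ _).trans (ha.const_smul c), ?_⟩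
    rw [classicalGrad_smul c hφ.smooth]
    exact (Lp.coeFn_smul _ _).trans (ha'.const_smul c)

/-- The velocity space `X = H¹₀(Ω)²`: the closure of the test fields in the `H¹` norm.
An element is stored as the pair of a field `v ∈ L²(Ω)²` and its weak gradient
`∇v ∈ L²(Ω)^{2×2}` (which is determined by `v`). -/
def X (Ω : Set Plane) : Submodule ℝ (L2 Plane Ω × L2 Tensor Ω) :=
  (testGraph Ω).topologicalClosure

variable {Ω : Set Plane}

/-- The field `v` itself, as an element of `L²(Ω)²`. -/
def val (v : X Ω) : L2 Plane Ω := v.1.1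

/-- The weak gradient `∇v`. -/
def grad (v : X Ω) : L2 Tensor Ω := v.1.2

/-- The trace of a tensor. -/
def traceL : Tensor →L[ℝ] ℝ := ∑ i : Fin 2, EuclideanSpace.proj (i, i)

/-- The divergence `∇ · v`. -/
def divg (v : X Ω) : L2 ℝ Ω := traceL.compLp (grad v)

/-- The norm of `v` in `L⁴(Ω)²` (finite for every `v` in `H¹₀(Ω)²`, as `Ω` is planar). -/
def normL4 (v : X Ω) : ℝ := (eLpNorm (val v) 4 (vol Ω)).toReal

/-- The pressure space `Q = L²₀(Ω)` of square integrable functions with mean value zero. -/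
def Q (Ω : Set Plane) : Set (L2 ℝ Ω) := {q | ∫ x in Ω, q x = 0}

/-- The convective form `(u · ∇v, w)`. -/
def conv (u v w : X Ω) : ℝ :=
  ∫ x in Ω, ∑ i : Fin 2, (∑ k : Fin 2, val u x k * grad v x (i, k)) * val w x i

/-- The skew-symmetric trilinear form `b*(u, v, w)`. -/
def bstar (u v w : X Ω) : ℝ := (1 / 2) * conv u v w - (1 / 2) * conv u w v

/-- The dual norm `‖f‖₋₁ = sup_{0 ≠ v ∈ X} (f, v) / ‖∇v‖` of a bounded functional on `X`. -/
def dualNorm (f : X Ω →L[ℝ] ℝ) : ℝ :=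
  sSup {r | ∃ v : X Ω, v ≠ 0 ∧ r = f v / ‖grad v‖}

/-- The extrapolation `3 wⁿ - 3 wⁿ⁻¹ + wⁿ⁻²` (used for `n ≥ 2` only). -/
def extrap (w : ℕ → X Ω) (n : ℕ) : X Ω :=
  (3 : ℝ) • w n - (3 : ℝ) • w (n - 1) + w (n - 2)

/-- The ensemble mean `⟨u⟩ⁿ` (used for `n ≥ 2` only). -/
def mean {J : ℕ} (u : Fin J → ℕ → X Ω) (n : ℕ) : X Ω :=
  (1 / (J : ℝ)) • ∑ j, extrap (u j) n

/-- The fluctuation `u'ⱼⁿ` (used for `n ≥ 2` only). -/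
def fluct {J : ℕ} (u : Fin J → ℕ → X Ω) (j : Fin J) (n : ℕ) : X Ω :=
  extrap (u j) n - mean u n

/-- The blended difference quotient `(10 wⁿ⁺¹ - 15 wⁿ + 6 wⁿ⁻¹ - wⁿ⁻²) / (6 Δt)`
(used for `n ≥ 2` only). -/
def blendedBDF (Δt : ℝ) (w : ℕ → X Ω) (n : ℕ) : X Ω :=
  (1 / (6 * Δt)) •
    ((10 : ℝ) • w (n + 1) - (15 : ℝ) • w n + (6 : ℝ) • w (n - 1) - w (n - 2))

/-- The inverse inequality `h ‖∇v‖ ≤ C ‖v‖` on a subspace of the velocity space. -/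
def InverseInequality (Xh : Submodule ℝ (X Ω)) (h C : ℝ) : Prop :=
  ∀ v ∈ Xh, h * ‖grad v‖ ≤ C * ‖val v‖

/-- `(u, p)` solves the fully discrete ensemble method in `Xh × Qh`, with viscosity `ν`,
time step `Δt` and forces `fⱼⁿ`, for the time levels up to `N`: all velocities
(the starting values at the levels `0, 1, 2` included) are in `Xh`,
and for `2 ≤ n < N` the discrete equations for the level `n + 1` hold. -/
structure IsDiscreteSolution (Xh : Submodule ℝ (X Ω)) (Qh : Submodule ℝ (L2 ℝ Ω))
    (ν Δt : ℝ) {J : ℕ} (f : Fin J → ℕ → X Ω →L[ℝ] ℝ) (N : ℕ)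
    (u : Fin J → ℕ → X Ω) (p : Fin J → ℕ → L2 ℝ Ω) : Prop where
  velocity_mem : ∀ j, ∀ n ≤ N, u j n ∈ Xh
  pressure_mem : ∀ j n, 2 ≤ n → n < N → p j (n + 1) ∈ Qh
  momentum : ∀ j n, 2 ≤ n → n < N → ∀ v ∈ Xh,
    inner ℝ (val (blendedBDF Δt (u j) n)) (val v)
      + bstar (mean u n) (u j (n + 1)) v
      + bstar (fluct u j n) (extrap (u j) n) v
      - inner ℝ (p j (n + 1)) (divg v)
      + ν * inner ℝ (grad (u j (n + 1))) (grad v) = f j (n + 1) v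
  incompressible : ∀ j n, 2 ≤ n → n < N → ∀ q ∈ Qh, inner ℝ (divg (u j (n + 1))) q = 0

/-- The energy `(‖wⁿ‖² + ‖3wⁿ - wⁿ⁻¹‖² + ‖3wⁿ - 3wⁿ⁻¹ + wⁿ⁻²‖²) / 12`
(used for `n ≥ 2` only). -/
def energy (w : ℕ → X Ω) (n : ℕ) : ℝ :=
  (1 / 12) * ‖val (w n)‖ ^ 2 + (1 / 12) * ‖val ((3 : ℝ) • w n - w (n - 1))‖ ^ 2
    + (1 / 12) * ‖val (extrap w n)‖ ^ 2

end EnsembleNS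

end

open EnsembleNS

/-! The momentum equation is tested with `u j (n + 1)`. The pressure drops out by discrete
incompressibility, and the term convected by the mean vanishes by skew symmetry. By
`inner_blended_eq`, the difference quotient gives an increment of the energy plus `‖D‖² / 12`, where
`D` is the third difference in time. The extrapolation equals `u j (n + 1) - D`, so skew symmetry
reduces the fluctuation term to `-b*(u', D, u j (n + 1))`.

This term is absorbed by viscosity and by `‖D‖²`. Integration by parts (`convDefect_eq_zero`) takes
the derivative off `D`, and Hölder's inequality then leaves only its `L⁴` norm. Ladyzhenskaya's
inequality and the inverse inequality give `h ‖D‖_{L⁴}² ≲ ‖D‖²`. This costs a single power of `h`,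
which is the power in the time-step condition (`exists_abs_bstar_le`). Young's inequality and
summation over the time levels finish the proof.

The Poincaré and Ladyzhenskaya inequalities both come from the planar `L¹` Sobolev inequality,
applied to `φ` and to `|φ|²` for test fields `φ`, and extend to the closure. -/

namespace EnsembleNS

open Filter Topology
open scoped NNReal ENNReal

variable {Ω : Set Plane}

/-! ### Pointwise bounds on gradients and convection -/

/-- The pointwise convection integrand is bounded by the product of the Euclidean norms. -/
theorem abs_convection_le (a : Plane) (G : Tensor) (b : Plane) :
    |∑ i : Fin 2, (∑ k : Fin 2, a k * G (i, k)) * b i| ≤ ‖a‖ * ‖G‖ * ‖b‖ := by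
  refine abs_le_of_sq_le_sq ?_ (by positivity)
  rw [mul_pow, mul_pow, EuclideanSpace.norm_sq_eq, EuclideanSpace.norm_sq_eq,
    EuclideanSpace.norm_sq_eq, Fintype.sum_prod_type]
  simp only [Fin.sum_univ_two, Real.norm_eq_abs, sq_abs]
  -- Cauchy–Schwarz for `(G a) · b`; the square in the hint is its defect. The two squares at the
  -- end do the same for each row of `G`.
  have h1 : ((a 0 * G (0, 0) + a 1 * G (0, 1)) * b 0 + (a 0 * G (1, 0) + a 1 * G (1, 1)) * b 1) ^ 2
      ≤ ((a 0 * G (0, 0) + a 1 * G (0, 1)) ^ 2 + (a 0 * G (1, 0) + a 1 * G (1, 1)) ^ 2)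
        * (b 0 ^ 2 + b 1 ^ 2) := by
    linarith [sq_nonneg ((a 0 * G (0, 0) + a 1 * G (0, 1)) * b 1
      - (a 0 * G (1, 0) + a 1 * G (1, 1)) * b 0)]
  refine h1.trans (mul_le_mul_of_nonneg_right ?_ (by positivity))
  linarith [sq_nonneg (a 0 * G (0, 1) - a 1 * G (0, 0)),
    sq_nonneg (a 0 * G (1, 1) - a 1 * G (1, 0))]

theorem fderiv_apply_eq_sum (φ : Plane → Plane) (x y : Plane) (i : Fin 2) :
    fderiv ℝ φ x y i = ∑ k : Fin 2, y k * classicalGrad φ x (i, k) := by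
  have hy : y = ∑ k : Fin 2, y k • EuclideanSpace.single k (1 : ℝ) := by
    ext l
    fin_cases l <;> simp [Fin.sum_univ_two]
  conv_lhs => rw [hy]
  simp [classicalGrad, Fin.sum_univ_two]

theorem norm_fderiv_le_norm_classicalGrad (φ : Plane → Plane) (x : Plane) :
    ‖fderiv ℝ φ x‖ ≤ ‖classicalGrad φ x‖ := by
  refine ContinuousLinearMap.opNorm_le_bound _ (norm_nonneg _) fun y => ?_
  -- Taking `b = dφ(y)` gives `‖dφ(y)‖² ≤ ‖y‖ ‖∇φ‖ ‖dφ(y)‖`, from which one factor is cancelled.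
  have h := abs_convection_le y (classicalGrad φ x) (fderiv ℝ φ x y)
  simp only [← fderiv_apply_eq_sum] at h
  have h2 : ∑ i : Fin 2, fderiv ℝ φ x y i * fderiv ℝ φ x y i = ‖fderiv ℝ φ x y‖ ^ 2 := by
    rw [EuclideanSpace.norm_sq_eq]
    simp [sq]
  rw [h2, abs_of_nonneg (by positivity)] at h
  rcases (norm_nonneg (fderiv ℝ φ x y)).eq_or_lt with h0 | h0
  · rw [← h0]; positivity
  · nlinarith

theorem classicalGrad_support_subset (φ : Plane → Plane) :
    Function.support (classicalGrad φ) ⊆ tsupport φ := by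
  intro x hx
  by_contra hn
  refine hx ?_
  have : fderiv ℝ φ x = 0 := by
    by_contra h
    exact hn (support_fderiv_subset ℝ (f := φ) h)
  ext ik
  simp [classicalGrad, this]

theorem IsTestField.continuous_classicalGrad {φ : Plane → Plane} (hφ : IsTestField Ω φ) :
    Continuous (classicalGrad φ) := by
  have h := hφ.smooth.continuous_fderiv (by simp)
  unfold classicalGrad
  fun_prop

/-! ### Sobolev, Poincaré and Ladyzhenskaya inequalities -/

theorem finrank_holderConjugate : NNReal.HolderConjugate (Module.finrank ℝ Plane) 2 := by
  have : (Module.finrank ℝ Plane : ℝ≥0) = 2 := by simp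
  rw [this]
  exact NNReal.HolderConjugate.two_two

/-- The `L¹` Sobolev inequality in the plane for functions supported in `Ω`. -/
theorem eLpNorm_two_le_fderiv_one {F : Type} [NormedAddCommGroup F] [NormedSpace ℝ F]
    [FiniteDimensional ℝ F] {φ : Plane → F} (hφ : ContDiff ℝ 1 φ) (hc : HasCompactSupport φ)
    (hs : tsupport φ ⊆ Ω) :
    eLpNorm φ 2 (vol Ω) ≤ eLpNormLESNormFDerivOneConst (volume : Measure Plane) 2
      * eLpNorm (fderiv ℝ φ) 1 (vol Ω) := by
  have h := eLpNorm_le_eLpNorm_fderiv_one (volume : Measure Plane) hφ hc finrank_holderConjugate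
  rw [eLpNorm_restrict_eq_of_support_subset (f := fderiv ℝ φ) ((support_fderiv_subset ℝ).trans hs)]
  exact (eLpNorm_restrict_le _ _ _ _).trans (by exact_mod_cast h)

/-- Poincaré's inequality for test fields. -/
theorem poincare_testField (hΩb : Bornology.IsBounded Ω) :
    ∃ K : ℝ≥0, ∀ φ, IsTestField Ω φ →
      eLpNorm φ 2 (vol Ω) ≤ K * eLpNorm (classicalGrad φ) 2 (vol Ω) := by
  have hfin : vol Ω Set.univ < ⊤ := by simpa using hΩb.measure_lt_top
  -- `|Ω|^{1/2}` is the cost of passing from the `L¹` to the `L²` norm of the gradient.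
  set c := (vol Ω Set.univ) ^ ((1 : ℝ) / 2) with hc
  have hcf : c ≠ ⊤ := ENNReal.rpow_ne_top_of_nonneg (by norm_num) hfin.ne
  refine ⟨eLpNormLESNormFDerivOneConst (volume : Measure Plane) 2 * c.toNNReal, fun φ hφ => ?_⟩
  refine (eLpNorm_two_le_fderiv_one (hφ.smooth.of_le (by simp)) hφ.compact
    hφ.support_subset).trans ?_
  rw [ENNReal.coe_mul, ENNReal.coe_toNNReal hcf, mul_assoc]
  gcongr
  refine (eLpNorm_mono (norm_fderiv_le_norm_classicalGrad φ)).trans ?_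
  refine (eLpNorm_le_eLpNorm_mul_rpow_measure_univ one_le_two
    hφ.continuous_classicalGrad.aestronglyMeasurable).trans_eq ?_
  rw [mul_comm, hc]
  norm_num

theorem holderTriple_four_four_two : ENNReal.HolderTriple 4 4 2 := by
  constructor
  have h4 : (4 : ℝ≥0∞) = 2 * 2 := by norm_num
  rw [h4, ENNReal.mul_inv (by simp) (by simp), ← two_mul, ← mul_assoc,
    ENNReal.mul_inv_cancel (by simp) (by simp), one_mul]

/-- Ladyzhenskaya's inequality for test fields. -/
theorem ladyzhenskaya_testField (Ω : Set Plane) :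
    ∃ K : ℝ≥0, ∀ φ, IsTestField Ω φ →
      eLpNorm φ 4 (vol Ω) ^ 2
        ≤ K * (eLpNorm φ 2 (vol Ω) * eLpNorm (classicalGrad φ) 2 (vol Ω)) := by
  refine ⟨eLpNormLESNormFDerivOneConst (volume : Measure Plane) 2 * 2, fun φ hφ => ?_⟩
  have hsq : eLpNorm (fun x => ‖φ x‖ ^ 2) 2 (vol Ω) = eLpNorm φ 4 (vol Ω) ^ 2 := by
    have := eLpNorm_norm_rpow (p := 2) (μ := vol Ω) φ (q := 2) (by norm_num)
    have h4 : (2 : ℝ≥0∞) * ENNReal.ofReal 2 = 4 := by norm_num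
    rw [h4] at this
    exact_mod_cast this
  have hs : Function.support (fun x => ‖φ x‖ ^ 2) ⊆ tsupport φ := fun x hx =>
    subset_tsupport φ fun h0 => hx (by simp [h0])
  have hts : tsupport (fun x => ‖φ x‖ ^ 2) ⊆ tsupport φ := closure_minimal hs (isClosed_tsupport φ)
  have h1 : ContDiff ℝ 1 φ := hφ.smooth.of_le (by simp)
  rw [← hsq]
  refine (eLpNorm_two_le_fderiv_one (h1.norm_sq ℝ)
    (hφ.compact.mono' hs) (hts.trans hφ.support_subset)).trans ?_
  rw [ENNReal.coe_mul, mul_assoc]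
  gcongr
  -- Chain rule: `|∇|φ|²| ≤ 2 |φ| |∇φ|`, the source of the factor `2` in the constant.
  have hpt : ∀ x, ‖fderiv ℝ (fun x => ‖φ x‖ ^ 2) x‖ ≤ ‖(2 : ℝ) * (‖φ x‖ * ‖classicalGrad φ x‖)‖ := by
    intro x
    rw [(((h1.differentiable (by simp)) x).hasFDerivAt.norm_sq).fderiv,
      Real.norm_of_nonneg (by positivity), two_nsmul, ← two_smul ℝ, norm_smul,
      Real.norm_of_nonneg zero_le_two]
    gcongr
    refine (ContinuousLinearMap.opNorm_comp_le _ _).trans ?_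
    rw [innerSL_apply_norm]
    gcongr
    exact norm_fderiv_le_norm_classicalGrad φ x
  refine (eLpNorm_mono hpt).trans ?_
  have := eLpNorm_le_eLpNorm_mul_eLpNorm_of_nnnorm (μ := vol Ω) (p := 2) (q := 2) (r := 1)
    hφ.smooth.continuous.aestronglyMeasurable hφ.continuous_classicalGrad.aestronglyMeasurable
    (fun a b => (2 : ℝ) * (‖a‖ * ‖b‖)) 2 (by
      refine Eventually.of_forall fun x => ?_
      simp [mul_assoc])
  simpa [mul_assoc] using this

/-- Poincaré's inequality in `H¹₀(Ω)²`. -/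
theorem poincare (hΩb : Bornology.IsBounded Ω) :
    ∃ K : ℝ, 0 ≤ K ∧ ∀ v : X Ω, ‖val v‖ ≤ K * ‖grad v‖ := by
  obtain ⟨K, hK⟩ := poincare_testField hΩb
  refine ⟨K, K.2, ?_⟩
  have hcl : IsClosed {g : L2 Plane Ω × L2 Tensor Ω | ‖g.1‖ ≤ K * ‖g.2‖} :=
    isClosed_le (by fun_prop) (by fun_prop)
  have hsub : (testGraph Ω : Set (L2 Plane Ω × L2 Tensor Ω)) ⊆ {g | ‖g.1‖ ≤ K * ‖g.2‖} := by
    rintro g ⟨φ, hφ, h1, h2⟩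
    have := hK φ hφ
    rw [← eLpNorm_congr_ae h1, ← eLpNorm_congr_ae h2, ← Lp.enorm_def, ← Lp.enorm_def] at this
    simp only [enorm_eq_nnnorm] at this
    exact_mod_cast this
  exact fun v => closure_minimal hsub hcl v.2

/-- Ladyzhenskaya's inequality in `H¹₀(Ω)²`. -/
theorem ladyzhenskaya (Ω : Set Plane) :
    ∃ K : ℝ, 0 ≤ K ∧ ∀ v : X Ω, MemLp (val v) 4 (vol Ω) ∧
      normL4 v ^ 2 ≤ K * (‖val v‖ * ‖grad v‖) := by
  obtain ⟨K, hK⟩ := ladyzhenskaya_testField Ω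
  -- Stated in `ℝ≥0∞`, so that finiteness of the `L⁴` norm is a consequence and not a prerequisite.
  have key : ∀ v : X Ω, eLpNorm (val v) 4 (vol Ω) ^ 2 ≤ K * (‖val v‖ₑ * ‖grad v‖ₑ) := by
    intro v
    obtain ⟨g, hg, hlim⟩ := mem_closure_iff_seq_limit.1 v.2
    have hlim1 : Tendsto (fun n => (g n).1) atTop (𝓝 (val v)) := (continuous_fst.tendsto _).comp hlim
    have hlim2 : Tendsto (fun n => (g n).2) atTop (𝓝 (grad v)) := (continuous_snd.tendsto _).comp hlim
    -- The `L⁴` norm is not continuous under `L²` convergence; Fatou's lemma along an a.e.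
    -- convergent subsequence gives the lower semicontinuity that suffices.
    obtain ⟨ns, hns, hae⟩ := (tendstoInMeasure_of_tendsto_Lp hlim1).exists_seq_tendsto_ae
    have hfatou := Lp.eLpNorm_lim_le_liminf_eLpNorm (p := 4)
      (fun n => Lp.aestronglyMeasurable (g (ns n)).1) _ hae
    have hbd : ∀ n, eLpNorm (g (ns n)).1 4 (vol Ω)
        ≤ (K * (‖(g (ns n)).1‖ₑ * ‖(g (ns n)).2‖ₑ)) ^ ((1 : ℝ) / 2) := by
      intro n
      obtain ⟨φ, hφ, h1, h2⟩ := hg (ns n)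
      have := hK φ hφ
      rw [← eLpNorm_congr_ae h1, ← eLpNorm_congr_ae h1, ← eLpNorm_congr_ae h2, ← Lp.enorm_def,
        ← Lp.enorm_def] at this
      refine le_trans ?_ (ENNReal.rpow_le_rpow this (by norm_num))
      rw [← ENNReal.rpow_natCast, ← ENNReal.rpow_mul]
      norm_num
    have hR : Tendsto (fun n => (K * (‖(g (ns n)).1‖ₑ * ‖(g (ns n)).2‖ₑ)) ^ ((1 : ℝ) / 2)) atTop
        (𝓝 ((K * (‖val v‖ₑ * ‖grad v‖ₑ)) ^ ((1 : ℝ) / 2))) := by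
      refine (ENNReal.continuous_rpow_const.tendsto _).comp ?_
      refine ENNReal.Tendsto.const_mul ?_ (Or.inr ENNReal.coe_ne_top)
      exact ENNReal.Tendsto.mul
        ((continuous_enorm.tendsto _).comp (hlim1.comp hns.tendsto_atTop)) (Or.inr enorm_ne_top)
        ((continuous_enorm.tendsto _).comp (hlim2.comp hns.tendsto_atTop)) (Or.inr enorm_ne_top)
    have h := hfatou.trans ((liminf_le_liminf (Eventually.of_forall hbd)).trans_eq hR.liminf_eq)
    have := ENNReal.rpow_le_rpow h (z := 2) (by norm_num)
    rw [← ENNReal.rpow_mul] at this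
    norm_num at this
    exact this
  refine ⟨K, K.2, fun v => ⟨⟨Lp.aestronglyMeasurable _, ?_⟩, ?_⟩⟩
  · by_contra h
    have := key v
    rw [not_lt, top_le_iff] at h
    rw [h] at this
    simp only [ne_eq, OfNat.ofNat_ne_zero, not_false_eq_true, ENNReal.top_pow, top_le_iff] at this
    exact ENNReal.mul_ne_top ENNReal.coe_ne_top (ENNReal.mul_ne_top enorm_ne_top enorm_ne_top) this
  · have := ENNReal.toReal_mono
      (ENNReal.mul_ne_top ENNReal.coe_ne_top (ENNReal.mul_ne_top enorm_ne_top enorm_ne_top)) (key v)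
    simpa [normL4] using this

/-! ### Hölder bounds and linearity of the trilinear forms -/

/-- Hölder's inequality with exponents `4, 2, 4`. -/
theorem integral_norm_mul_norm_mul_norm_le {α E F G : Type*} [MeasurableSpace α] {μ : Measure α}
    [NormedAddCommGroup E] [NormedAddCommGroup F] [NormedAddCommGroup G]
    {f : α → E} {g : α → F} {k : α → G} (hf : MemLp f 4 μ) (hg : MemLp g 2 μ) (hk : MemLp k 4 μ) :
    Integrable (fun x => ‖f x‖ * ‖g x‖ * ‖k x‖) μ ∧
      ∫ x, ‖f x‖ * ‖g x‖ * ‖k x‖ ∂μ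
        ≤ (eLpNorm f 4 μ).toReal * (eLpNorm g 2 μ).toReal * (eLpNorm k 4 μ).toReal := by
  have := holderTriple_four_four_two
  have hfk : MemLp (fun x => ‖f x‖ * ‖k x‖) 2 μ := hk.norm.mul hf.norm
  have hint : Integrable (fun x => ‖g x‖ * (‖f x‖ * ‖k x‖)) μ :=
    memLp_one_iff_integrable.1 (hfk.mul hg.norm)
  have heq : (fun x => ‖f x‖ * ‖g x‖ * ‖k x‖) = fun x => ‖g x‖ * (‖f x‖ * ‖k x‖) := by
    funext x; ring
  rw [heq]
  refine ⟨hint, ?_⟩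
  have h1 : eLpNorm (fun x => ‖f x‖ * ‖k x‖) 2 μ ≤ eLpNorm f 4 μ * eLpNorm k 4 μ := by
    have := eLpNorm_smul_le_mul_eLpNorm (p := 4) (q := 4) (r := 2) hk.norm.1 hf.norm.1
    rwa [eLpNorm_norm, eLpNorm_norm] at this
  have h2 : eLpNorm (fun x => ‖g x‖ * (‖f x‖ * ‖k x‖)) 1 μ
      ≤ eLpNorm g 2 μ * (eLpNorm f 4 μ * eLpNorm k 4 μ) := by
    have := eLpNorm_smul_le_mul_eLpNorm (p := 2) (q := 2) (r := 1) hfk.1 hg.norm.1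
    rw [eLpNorm_norm] at this
    exact this.trans (by gcongr)
  have h3 : ∫ x, ‖g x‖ * (‖f x‖ * ‖k x‖) ∂μ
      = (eLpNorm (fun x => ‖g x‖ * (‖f x‖ * ‖k x‖)) 1 μ).toReal := by
    rw [eLpNorm_one_eq_lintegral_enorm, ← integral_norm_eq_lintegral_enorm hint.1]
    refine integral_congr_ae (Eventually.of_forall fun x => ?_)
    exact (Real.norm_of_nonneg (by positivity)).symm
  rw [h3]
  refine (ENNReal.toReal_mono (ENNReal.mul_ne_top hg.2.ne (ENNReal.mul_ne_top hf.2.ne hk.2.ne))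
    h2).trans_eq ?_
  rw [ENNReal.toReal_mul, ENNReal.toReal_mul]
  ring

theorem memLp_four (v : X Ω) : MemLp (val v) 4 (vol Ω) := by
  obtain ⟨K, -, hK⟩ := ladyzhenskaya Ω
  exact (hK v).1

theorem normL4_nonneg (v : X Ω) : 0 ≤ normL4 v := ENNReal.toReal_nonneg

theorem aestronglyMeasurable_convection {μ : Measure Plane} {a : Plane → Plane}
    {G : Plane → Tensor} {b : Plane → Plane} (ha : AEStronglyMeasurable a μ)
    (hG : AEStronglyMeasurable G μ) (hb : AEStronglyMeasurable b μ) :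
    AEStronglyMeasurable
      (fun x => ∑ i : Fin 2, (∑ k : Fin 2, a x k * G x (i, k)) * b x i) μ := by
  have ha' : ∀ k, AEStronglyMeasurable (fun x => a x k) μ := fun k =>
    (EuclideanSpace.proj k : Plane →L[ℝ] ℝ).continuous.comp_aestronglyMeasurable ha
  have hb' : ∀ k, AEStronglyMeasurable (fun x => b x k) μ := fun k =>
    (EuclideanSpace.proj k : Plane →L[ℝ] ℝ).continuous.comp_aestronglyMeasurable hb
  have hG' : ∀ ik, AEStronglyMeasurable (fun x => G x ik) μ := fun ik =>
    (EuclideanSpace.proj ik : Tensor →L[ℝ] ℝ).continuous.comp_aestronglyMeasurable hG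
  exact Finset.aestronglyMeasurable_fun_sum _ fun i _ =>
    (Finset.aestronglyMeasurable_fun_sum _ fun k _ => (ha' k).mul (hG' (i, k))).mul (hb' i)

theorem convection_integrable_and_le (u v w : X Ω) :
    Integrable (fun x => ∑ i : Fin 2, (∑ k : Fin 2, val u x k * grad v x (i, k)) * val w x i)
      (vol Ω) ∧ |conv u v w| ≤ normL4 u * ‖grad v‖ * normL4 w := by
  obtain ⟨h1, h2⟩ := integral_norm_mul_norm_mul_norm_le (memLp_four u) (Lp.memLp (grad v))
    (memLp_four w)
  have hm := aestronglyMeasurable_convection (Lp.aestronglyMeasurable (val u))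
    (Lp.aestronglyMeasurable (grad v)) (Lp.aestronglyMeasurable (val w))
  have hb : ∀ x, ‖∑ i : Fin 2, (∑ k : Fin 2, val u x k * grad v x (i, k)) * val w x i‖
      ≤ ‖val u x‖ * ‖grad v x‖ * ‖val w x‖ := fun x => abs_convection_le _ _ _
  refine ⟨h1.mono' hm (Eventually.of_forall hb), ?_⟩
  exact (norm_integral_le_of_norm_le h1 (Eventually.of_forall hb)).trans h2

theorem integrable_convection (u v w : X Ω) :
    Integrable (fun x => ∑ i : Fin 2, (∑ k : Fin 2, val u x k * grad v x (i, k)) * val w x i)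
      (vol Ω) := (convection_integrable_and_le u v w).1

theorem abs_conv_le (u v w : X Ω) : |conv u v w| ≤ normL4 u * ‖grad v‖ * normL4 w :=
  (convection_integrable_and_le u v w).2

theorem coeFn_val_sub (v w : X Ω) : ∀ᵐ x ∂vol Ω, val (v - w) x = val v x - val w x :=
  Lp.coeFn_sub (val v) (val w)

theorem coeFn_grad_sub (v w : X Ω) : ∀ᵐ x ∂vol Ω, grad (v - w) x = grad v x - grad w x :=
  Lp.coeFn_sub (grad v) (grad w)

theorem coeFn_divg (v : X Ω) : ∀ᵐ x ∂vol Ω, divg v x = grad v x (0, 0) + grad v x (1, 1) := by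
  filter_upwards [traceL.coeFn_compLp (grad v)] with x hx
  rw [divg, hx]
  simp [traceL]

theorem coeFn_divg_sub (v w : X Ω) : ∀ᵐ x ∂vol Ω, divg (v - w) x = divg v x - divg w x := by
  filter_upwards [coeFn_divg v, coeFn_divg w, coeFn_divg (v - w), coeFn_grad_sub v w]
    with x h1 h2 h3 h4
  rw [h1, h2, h3, h4]
  simp only [PiLp.sub_apply]
  ring

theorem conv_sub_left (u u' v w : X Ω) : conv (u - u') v w = conv u v w - conv u' v w := by
  unfold conv
  rw [← integral_sub (integrable_convection u v w) (integrable_convection u' v w)]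
  refine integral_congr_ae ?_
  filter_upwards [coeFn_val_sub u u'] with x hx
  simp only [hx, Fin.sum_univ_two, PiLp.sub_apply]
  ring

theorem conv_sub_middle (u v v' w : X Ω) : conv u (v - v') w = conv u v w - conv u v' w := by
  unfold conv
  rw [← integral_sub (integrable_convection u v w) (integrable_convection u v' w)]
  refine integral_congr_ae ?_
  filter_upwards [coeFn_grad_sub v v'] with x hx
  simp only [hx, Fin.sum_univ_two, PiLp.sub_apply]
  ring

theorem conv_sub_right (u v w w' : X Ω) : conv u v (w - w') = conv u v w - conv u v w' := by
  unfold conv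
  rw [← integral_sub (integrable_convection u v w) (integrable_convection u v w')]
  refine integral_congr_ae ?_
  filter_upwards [coeFn_val_sub w w'] with x hx
  simp only [hx, Fin.sum_univ_two, PiLp.sub_apply]
  ring

/-- The form `(∇ · u, v · w)`. -/
noncomputable def divForm (u v w : X Ω) : ℝ :=
  ∫ x in Ω, divg u x * ∑ i : Fin 2, val v x i * val w x i

theorem divForm_integrable_and_le (u v w : X Ω) :
    Integrable (fun x => divg u x * ∑ i : Fin 2, val v x i * val w x i) (vol Ω) ∧
      |divForm u v w| ≤ ‖divg u‖ * normL4 v * normL4 w := by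
  obtain ⟨h1, h2⟩ := integral_norm_mul_norm_mul_norm_le (memLp_four v) (Lp.memLp (divg u))
    (memLp_four w)
  have hm : AEStronglyMeasurable
      (fun x => divg u x * ∑ i : Fin 2, val v x i * val w x i) (vol Ω) := by
    have hc : Continuous fun t : ℝ × Plane × Plane =>
        t.1 * ∑ i : Fin 2, t.2.1 i * t.2.2 i := by fun_prop
    exact hc.comp_aestronglyMeasurable ((Lp.aestronglyMeasurable (divg u)).prodMk
      ((Lp.aestronglyMeasurable (val v)).prodMk (Lp.aestronglyMeasurable (val w))))
  have hb : ∀ x, ‖divg u x * ∑ i : Fin 2, val v x i * val w x i‖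
      ≤ ‖val v x‖ * ‖divg u x‖ * ‖val w x‖ := by
    intro x
    have := abs_real_inner_le_norm (val v x) (val w x)
    rw [PiLp.inner_apply] at this
    simp only [Real.inner_apply] at this
    rw [norm_mul, mul_comm ‖val v x‖, mul_assoc]
    exact mul_le_mul_of_nonneg_left this (norm_nonneg _)
  refine ⟨h1.mono' hm (Eventually.of_forall hb), ?_⟩
  refine ((norm_integral_le_of_norm_le h1 (Eventually.of_forall hb)).trans h2).trans_eq ?_
  rw [Lp.norm_def, normL4, normL4]
  ring

theorem integrable_divForm (u v w : X Ω) :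
    Integrable (fun x => divg u x * ∑ i : Fin 2, val v x i * val w x i) (vol Ω) :=
  (divForm_integrable_and_le u v w).1

theorem abs_divForm_le (u v w : X Ω) : |divForm u v w| ≤ ‖divg u‖ * normL4 v * normL4 w :=
  (divForm_integrable_and_le u v w).2

theorem divForm_sub_left (u u' v w : X Ω) :
    divForm (u - u') v w = divForm u v w - divForm u' v w := by
  unfold divForm
  rw [← integral_sub (integrable_divForm u v w) (integrable_divForm u' v w)]
  refine integral_congr_ae ?_
  filter_upwards [coeFn_divg_sub u u'] with x hx
  rw [hx, sub_mul]

theorem divForm_comm (u v w : X Ω) : divForm u v w = divForm u w v := by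
  simp only [divForm, mul_comm (val v _ _)]

theorem divForm_sub_middle (u v v' w : X Ω) :
    divForm u (v - v') w = divForm u v w - divForm u v' w := by
  unfold divForm
  rw [← integral_sub (integrable_divForm u v w) (integrable_divForm u v' w)]
  refine integral_congr_ae ?_
  filter_upwards [coeFn_val_sub v v'] with x hx
  simp only [hx, Fin.sum_univ_two, PiLp.sub_apply]
  ring

/-! ### Integration by parts in the velocity space -/

/-- The defect in the integration by parts of the convective form. -/
noncomputable def convDefect (u v w : X Ω) : ℝ := conv u v w + conv u w v + divForm u v w

theorem convDefect_comm (u v w : X Ω) : convDefect u v w = convDefect u w v := by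
  rw [convDefect, convDefect, divForm_comm]
  ring

theorem convDefect_sub_left (u u' v w : X Ω) :
    convDefect (u - u') v w = convDefect u v w - convDefect u' v w := by
  simp only [convDefect, conv_sub_left, divForm_sub_left]
  ring

theorem convDefect_sub_middle (u v v' w : X Ω) :
    convDefect u (v - v') w = convDefect u v w - convDefect u v' w := by
  simp only [convDefect, conv_sub_middle, conv_sub_right, divForm_sub_middle]
  ring

theorem norm_val_le (v : X Ω) : ‖val v‖ ≤ ‖v‖ := norm_fst_le v.1

theorem norm_grad_le (v : X Ω) : ‖grad v‖ ≤ ‖v‖ := norm_snd_le v.1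

theorem exists_normL4_le (Ω : Set Plane) : ∃ L : ℝ, 0 ≤ L ∧ ∀ v : X Ω, normL4 v ≤ L * ‖v‖ := by
  obtain ⟨K, hK0, hK⟩ := ladyzhenskaya Ω
  refine ⟨√K, Real.sqrt_nonneg K, fun v => ?_⟩
  refine le_of_sq_le_sq ?_ (by positivity)
  rw [mul_pow, Real.sq_sqrt hK0, sq ‖v‖]
  refine (hK v).2.trans ?_
  gcongr
  exacts [norm_val_le v, norm_grad_le v]

/-- Continuity in each argument is what lets the identity pass from test fields to their closure. -/
theorem exists_abs_convDefect_le (Ω : Set Plane) :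
    ∃ M : ℝ, ∀ u v w : X Ω, |convDefect u v w| ≤ M * ‖u‖ * ‖v‖ * ‖w‖ := by
  obtain ⟨L, hL0, hL⟩ := exists_normL4_le Ω
  refine ⟨2 * L ^ 2 + ‖traceL‖ * L ^ 2, fun u v w => ?_⟩
  have h1 : normL4 u * ‖grad v‖ * normL4 w ≤ (L * ‖u‖) * ‖v‖ * (L * ‖w‖) := by
    have := normL4_nonneg w
    gcongr
    exacts [hL u, norm_grad_le v, hL w]
  have h2 : normL4 u * ‖grad w‖ * normL4 v ≤ (L * ‖u‖) * ‖w‖ * (L * ‖v‖) := by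
    have := normL4_nonneg v
    gcongr
    exacts [hL u, norm_grad_le w, hL v]
  have h3 : ‖divg u‖ * normL4 v * normL4 w ≤ (‖traceL‖ * ‖u‖) * (L * ‖v‖) * (L * ‖w‖) := by
    have := normL4_nonneg v
    have := normL4_nonneg w
    have hd : ‖divg u‖ ≤ ‖traceL‖ * ‖u‖ :=
      (traceL.norm_compLp_le (grad u)).trans (by gcongr; exact norm_grad_le u)
    gcongr
    exacts [hL v, hL w]
  have := abs_conv_le u v w
  have := abs_conv_le u w v
  have := abs_divForm_le u v w
  calc |convDefect u v w| ≤ |conv u v w| + |conv u w v| + |divForm u v w| := abs_add_three _ _ _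
    _ ≤ (L * ‖u‖) * ‖v‖ * (L * ‖w‖) + (L * ‖u‖) * ‖w‖ * (L * ‖v‖)
        + (‖traceL‖ * ‖u‖) * (L * ‖v‖) * (L * ‖w‖) := by linarith
    _ = _ := by ring

/-- A bounded additive functional on `X` that vanishes on test fields is zero. -/
theorem eq_zero_of_testGraph {T : X Ω → ℝ} {M : ℝ} (hsub : ∀ v w, T (v - w) = T v - T w)
    (hM : ∀ v, |T v| ≤ M * ‖v‖) (h0 : ∀ v : X Ω, v.1 ∈ testGraph Ω → T v = 0) (v : X Ω) :
    T v = 0 := by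
  -- Compatibility with subtraction turns the bound into a Lipschitz estimate, so `T` is continuous
  -- and density applies.
  have hlip : LipschitzWith (Real.toNNReal M) T := by
    refine LipschitzWith.of_dist_le_mul fun v w => ?_
    rw [Real.dist_eq, ← hsub, dist_eq_norm]
    exact (hM _).trans (by gcongr; exact Real.le_coe_toNNReal M)
  obtain ⟨g, hg, hlim⟩ := mem_closure_iff_seq_limit.1 v.2
  let g' : ℕ → X Ω := fun n => ⟨g n, subset_closure (hg n)⟩
  have hlim' : Tendsto g' atTop (𝓝 v) := tendsto_subtype_rng.2 hlim
  have h1 : Tendsto (fun n => T (g' n)) atTop (𝓝 (T v)) := (hlip.continuous.tendsto v).comp hlim'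
  have h2 : (fun n => T (g' n)) = fun _ => 0 := funext fun n => h0 _ (hg n)
  rw [h2] at h1
  exact tendsto_nhds_unique h1 tendsto_const_nhds

/-- `∫ ∂ₑ(f g) = 0` for smooth functions, one of them with compact support. -/
theorem integral_mul_fderiv_add_fderiv_mul {f g : Plane → ℝ} (hf : ContDiff ℝ ∞ f)
    (hg : ContDiff ℝ ∞ g) (hfc : HasCompactSupport f) (e : Plane) :
    Integrable (fun x => f x * fderiv ℝ g x e + fderiv ℝ f x e * g x) ∧
      ∫ x, (f x * fderiv ℝ g x e + fderiv ℝ f x e * g x) = 0 := by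
  have hf' : Continuous fun x => fderiv ℝ f x e :=
    (hf.continuous_fderiv (by simp)).clm_apply continuous_const
  have hg' : Continuous fun x => fderiv ℝ g x e :=
    (hg.continuous_fderiv (by simp)).clm_apply continuous_const
  have h1 : Integrable fun x => fderiv ℝ f x e * g x :=
    (hf'.mul hg.continuous).integrable_of_hasCompactSupport (hfc.fderiv_apply ℝ e).mul_right
  have h2 : Integrable fun x => f x * fderiv ℝ g x e :=
    (hf.continuous.mul hg').integrable_of_hasCompactSupport hfc.mul_right
  have h3 : Integrable fun x => f x * g x :=
    (hf.continuous.mul hg.continuous).integrable_of_hasCompactSupport hfc.mul_right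
  refine ⟨h2.add h1, ?_⟩
  rw [integral_add h2 h1, integral_mul_fderiv_eq_neg_fderiv_mul_of_integrable h1 h2 h3
    (fun x _ => hf.differentiable (by simp) x) (fun x _ => hg.differentiable (by simp) x)]
  ring

theorem fderiv_coord (φ : Plane → Plane) {x : Plane} (hφ : DifferentiableAt ℝ φ x)
    (i k : Fin 2) :
    fderiv ℝ (fun y => φ y i) x (EuclideanSpace.single k 1) = classicalGrad φ x (i, k) := by
  have h := ((EuclideanSpace.proj i : Plane →L[ℝ] ℝ).hasFDerivAt (x := φ x)).comp x hφ.hasFDerivAt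
  have h' : HasFDerivAt (fun y => φ y i) ((EuclideanSpace.proj i : Plane →L[ℝ] ℝ) ∘L fderiv ℝ φ x) x :=
    h
  rw [h'.fderiv]
  rfl

/-- With `s = ψ · χ`, the three integrands add up to the divergence of `s φ`. This field has compact
support in `Ω`, so its divergence integrates to zero. -/
theorem convDefect_testGraph {u v w : X Ω} (hu : u.1 ∈ testGraph Ω) (hv : v.1 ∈ testGraph Ω)
    (hw : w.1 ∈ testGraph Ω) : convDefect u v w = 0 := by
  obtain ⟨φ, hφ, hu1, hu2⟩ := hu
  obtain ⟨ψ, hψ, hv1, hv2⟩ := hv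
  obtain ⟨χ, hχ, hw1, hw2⟩ := hw
  have hφi : ∀ i, ContDiff ℝ ∞ fun x => φ x i := fun i => by
    have := hφ.smooth; fun_prop
  have hψi : ∀ i, ContDiff ℝ ∞ fun x => ψ x i := fun i => by
    have := hψ.smooth; fun_prop
  have hχi : ∀ i, ContDiff ℝ ∞ fun x => χ x i := fun i => by
    have := hχ.smooth; fun_prop
  let s : Plane → ℝ := fun x => ψ x 0 * χ x 0 + ψ x 1 * χ x 1
  have hs : ContDiff ℝ ∞ s := ((hψi 0).mul (hχi 0)).add ((hψi 1).mul (hχi 1))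
  have hφc : ∀ i, HasCompactSupport fun x => φ x i := fun i =>
    hφ.compact.comp_left (g := fun y : Plane => y i) rfl
  let e : Fin 2 → Plane := fun k => EuclideanSpace.single k 1
  let I : Fin 2 → Plane → ℝ := fun k x =>
    φ x k * fderiv ℝ s x (e k) + fderiv ℝ (fun y => φ y k) x (e k) * s x
  have hI : ∀ k, Integrable (I k) ∧ ∫ x, I k x = 0 := fun k =>
    integral_mul_fderiv_add_fderiv_mul (hφi k) hs (hφc k) (e k)
  have hdφ : ∀ x, DifferentiableAt ℝ φ x := hφ.smooth.differentiable (by simp)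
  have hdψ : ∀ x, DifferentiableAt ℝ ψ x := hψ.smooth.differentiable (by simp)
  have hdχ : ∀ x, DifferentiableAt ℝ χ x := hχ.smooth.differentiable (by simp)
  have hds : ∀ x k, fderiv ℝ s x (e k) =
      (ψ x 0 * classicalGrad χ x (0, k) + classicalGrad ψ x (0, k) * χ x 0)
      + (ψ x 1 * classicalGrad χ x (1, k) + classicalGrad ψ x (1, k) * χ x 1) := by
    intro x k
    have hp : ∀ i, HasFDerivAt (fun y => ψ y i) (fderiv ℝ (fun y => ψ y i) x) x := fun i =>
      ((hψi i).differentiable (by simp) x).hasFDerivAt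
    have hc : ∀ i, HasFDerivAt (fun y => χ y i) (fderiv ℝ (fun y => χ y i) x) x := fun i =>
      ((hχi i).differentiable (by simp) x).hasFDerivAt
    have := (((hp 0).mul (hc 0)).add ((hp 1).mul (hc 1))).fderiv
    have hs' : fderiv ℝ s x = _ := this
    rw [hs']
    simp only [add_apply, smul_apply, e,
      fderiv_coord _ (hdψ x), fderiv_coord _ (hdχ x), smul_eq_mul]
    ring
  have hsum : convDefect u v w = ∫ x in Ω, (I 0 x + I 1 x) := by
    unfold convDefect conv divForm
    rw [← integral_add (integrable_convection u v w) (integrable_convection u w v),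
      ← integral_add ((integrable_convection u v w).fun_add (integrable_convection u w v))
        (integrable_divForm u v w)]
    refine integral_congr_ae ?_
    have hu1' : ∀ᵐ x ∂vol Ω, val u x = φ x := hu1
    have hv1' : ∀ᵐ x ∂vol Ω, val v x = ψ x := hv1
    have hw1' : ∀ᵐ x ∂vol Ω, val w x = χ x := hw1
    have hu2' : ∀ᵐ x ∂vol Ω, grad u x = classicalGrad φ x := hu2
    have hv2' : ∀ᵐ x ∂vol Ω, grad v x = classicalGrad ψ x := hv2
    have hw2' : ∀ᵐ x ∂vol Ω, grad w x = classicalGrad χ x := hw2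
    filter_upwards [hu1', hv1', hw1', hu2', hv2', hw2', coeFn_divg u] with x h1 h2 h3 h4 h5 h6 h7
    simp only [h1, h2, h3, h4, h5, h6, h7, I, hds, Fin.sum_univ_two]
    simp only [e, fderiv_coord _ (hdφ x), s]
    ring
  have hzero : ∀ x, x ∉ Ω → I 0 x + I 1 x = 0 := by
    intro x hx
    have hxt : x ∉ tsupport φ := fun h => hx (hφ.support_subset h)
    have h0 : φ x = 0 := image_eq_zero_of_notMem_tsupport hxt
    have h1 : classicalGrad φ x = 0 := by
      by_contra h
      exact hxt (classicalGrad_support_subset φ h)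
    simp only [I, e, fderiv_coord _ (hdφ x), h0, h1]
    simp
  rw [hsum, setIntegral_eq_integral_of_forall_compl_eq_zero hzero,
    integral_add (hI 0).1 (hI 1).1, (hI 0).2, (hI 1).2, add_zero]

/-- Integration by parts: `(u · ∇v, w) + (u · ∇w, v) = -(∇ · u, v · w)` in `H¹₀(Ω)²`. -/
theorem convDefect_eq_zero (u v w : X Ω) : convDefect u v w = 0 := by
  obtain ⟨M, hM⟩ := exists_abs_convDefect_le Ω
  -- The arguments are freed from the test fields one at a time; symmetry in the last two reduces
  -- the third to the second.
  have hleft : ∀ v w : X Ω, v.1 ∈ testGraph Ω → w.1 ∈ testGraph Ω → ∀ u, convDefect u v w = 0 := by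
    intro v w hv hw u
    refine eq_zero_of_testGraph (T := fun u => convDefect u v w) (M := M * ‖v‖ * ‖w‖)
      (fun a b => convDefect_sub_left a b v w) (fun a => (hM a v w).trans_eq (by ring))
      (fun a ha => convDefect_testGraph ha hv hw) u
  have hmid : ∀ w : X Ω, w.1 ∈ testGraph Ω → ∀ u v, convDefect u v w = 0 := by
    intro w hw u v
    refine eq_zero_of_testGraph (T := fun v => convDefect u v w) (M := M * ‖u‖ * ‖w‖)
      (fun a b => convDefect_sub_middle u a b w) (fun a => (hM u a w).trans_eq (by ring))
      (fun a ha => hleft a w ha hw u) v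
  rw [convDefect_comm]
  refine eq_zero_of_testGraph (T := fun w => convDefect u w v) (M := M * ‖u‖ * ‖v‖)
    (fun a b => convDefect_sub_middle u a b v) (fun a => (hM u a v).trans_eq (by ring))
    (fun a ha => ?_) w
  rw [convDefect_comm]
  exact hmid a ha u v

/-! ### Bounds for the skew-symmetric form and the forces -/

theorem bstar_eq (u v w : X Ω) : bstar u v w = -conv u w v - (1 / 2) * divForm u v w := by
  have := convDefect_eq_zero u v w
  unfold convDefect at this
  unfold bstar
  linarith

theorem bstar_self (u v : X Ω) : bstar u v v = 0 := sub_self _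

theorem bstar_sub_middle (u v v' w : X Ω) : bstar u (v - v') w = bstar u v w - bstar u v' w := by
  simp only [bstar, conv_sub_middle, conv_sub_right]
  ring

/-- The bound of the skew-symmetric form on functions satisfying an inverse inequality. -/
theorem exists_abs_bstar_le (hΩb : Bornology.IsBounded Ω) (Cinv : ℝ) :
    ∃ K : ℝ, 0 < K ∧ ∀ (h : ℝ) (u v w : X Ω), 0 < h → h * ‖grad v‖ ≤ Cinv * ‖val v‖ →
      h * bstar u v w ^ 2
        ≤ K * (normL4 u + ‖divg u‖) ^ 2 * ‖grad w‖ ^ 2 * ‖val v‖ ^ 2 := by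
  obtain ⟨P, hP0, hP⟩ := poincare hΩb
  obtain ⟨L, hL0, hL⟩ := ladyzhenskaya Ω
  -- `L * |Cinv|` comes from `h4v` and `1 + L * P` from `hcs`; the final `+ 1` only ensures
  -- positivity.
  refine ⟨(1 + L * P) * (L * |Cinv|) + 1, by positivity, fun h u v w hh hv => ?_⟩
  have hu4 := normL4_nonneg u
  have hv4 := normL4_nonneg v
  have hw4 := normL4_nonneg w
  have hv' : h * ‖grad v‖ ≤ |Cinv| * ‖val v‖ :=
    hv.trans (by gcongr; exact le_abs_self Cinv)
  have h4v : h * normL4 v ^ 2 ≤ L * |Cinv| * ‖val v‖ ^ 2 := by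
    calc h * normL4 v ^ 2 ≤ h * (L * (‖val v‖ * ‖grad v‖)) := by gcongr; exact (hL v).2
      _ = L * ‖val v‖ * (h * ‖grad v‖) := by ring
      _ ≤ L * ‖val v‖ * (|Cinv| * ‖val v‖) := by gcongr
      _ = _ := by ring
  have h4w : normL4 w ^ 2 ≤ L * P * ‖grad w‖ ^ 2 := by
    calc normL4 w ^ 2 ≤ L * (‖val w‖ * ‖grad w‖) := (hL w).2
      _ ≤ L * ((P * ‖grad w‖) * ‖grad w‖) := by gcongr; exact hP w
      _ = _ := by ring
  have hb : |bstar u v w| ≤ (normL4 u * ‖grad w‖ + ‖divg u‖ * normL4 w) * normL4 v := by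
    rw [bstar_eq]
    have h1 := abs_conv_le u w v
    have h2 := abs_divForm_le u v w
    -- Allows the factor `1 / 2` of the divergence term to be replaced by `1`.
    have h3 : 0 ≤ ‖divg u‖ * normL4 v * normL4 w := by positivity
    rw [abs_le] at h1 h2 ⊢
    constructor <;> nlinarith
  have hb2 : bstar u v w ^ 2 ≤ (normL4 u * ‖grad w‖ + ‖divg u‖ * normL4 w) ^ 2 * normL4 v ^ 2 := by
    rw [← mul_pow, ← sq_abs]
    gcongr
  have hcs : (normL4 u * ‖grad w‖ + ‖divg u‖ * normL4 w) ^ 2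
      ≤ (normL4 u + ‖divg u‖) ^ 2 * (1 + L * P) * ‖grad w‖ ^ 2 := by
    calc (normL4 u * ‖grad w‖ + ‖divg u‖ * normL4 w) ^ 2
        ≤ ((normL4 u ^ 2 + ‖divg u‖ ^ 2) * (‖grad w‖ ^ 2 + normL4 w ^ 2)) := by
          linarith [sq_nonneg (normL4 u * normL4 w - ‖divg u‖ * ‖grad w‖)]
      _ ≤ (normL4 u + ‖divg u‖) ^ 2 * (‖grad w‖ ^ 2 + L * P * ‖grad w‖ ^ 2) := by
          gcongr
          nlinarith [mul_nonneg hu4 (norm_nonneg (divg u))]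
      _ = _ := by ring
  calc h * bstar u v w ^ 2
      ≤ h * ((normL4 u * ‖grad w‖ + ‖divg u‖ * normL4 w) ^ 2 * normL4 v ^ 2) := by gcongr
    _ = (normL4 u * ‖grad w‖ + ‖divg u‖ * normL4 w) ^ 2 * (h * normL4 v ^ 2) := by ring
    _ ≤ ((normL4 u + ‖divg u‖) ^ 2 * (1 + L * P) * ‖grad w‖ ^ 2) * (L * |Cinv| * ‖val v‖ ^ 2) := by
        gcongr
    _ = ((1 + L * P) * (L * |Cinv|)) * (normL4 u + ‖divg u‖) ^ 2 * ‖grad w‖ ^ 2 * ‖val v‖ ^ 2 := by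
        ring
    _ ≤ _ := by
        gcongr
        linarith

/-- By Poincaré, `‖grad v‖` is equivalent to the norm of `X`. Hence the quotients in `dualNorm` are
bounded above, so the real `sSup` is a true supremum, and their denominators are positive. -/
theorem apply_le_dualNorm_mul (hΩb : Bornology.IsBounded Ω) (f : X Ω →L[ℝ] ℝ) (v : X Ω) :
    f v ≤ dualNorm f * ‖grad v‖ := by
  obtain ⟨P, hP0, hP⟩ := poincare hΩb
  have hn : ∀ w : X Ω, ‖w‖ ≤ (P + 1) * ‖grad w‖ := fun w => by
    refine max_le ((hP w).trans ?_) ?_ <;>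
    · change _ ≤ (P + 1) * ‖grad w‖
      first
        | nlinarith [norm_nonneg (grad w)]
        | (change ‖grad w‖ ≤ _; nlinarith [norm_nonneg (grad w)])
  have hpos : ∀ w : X Ω, w ≠ 0 → 0 < ‖grad w‖ := fun w hw => by
    by_contra hle
    have h0 : ‖grad w‖ = 0 := le_antisymm (not_lt.1 hle) (norm_nonneg _)
    have := hn w
    rw [h0, mul_zero] at this
    exact hw (norm_le_zero_iff.1 this)
  rcases eq_or_ne v 0 with rfl | hv
  · simp [grad]
  rw [← div_le_iff₀ (hpos v hv)]
  refine le_csSup ⟨‖f‖ * (P + 1), ?_⟩ ⟨v, hv, rfl⟩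
  rintro r ⟨w, hw, rfl⟩
  rw [div_le_iff₀ (hpos w hw), mul_assoc]
  exact (le_abs_self _).trans ((f.le_opNorm w).trans (by gcongr; exact hn w))

/-! ### The discrete energy estimate -/

theorem val_add (v w : X Ω) : val (v + w) = val v + val w := rfl

theorem val_sub (v w : X Ω) : val (v - w) = val v - val w := rfl

theorem val_smul (c : ℝ) (v : X Ω) : val (c • v) = c • val v := rfl

/-- The energy identity of the blended difference quotient in an inner product space. -/
theorem inner_blended_eq {E : Type*} [NormedAddCommGroup E] [InnerProductSpace ℝ E]
    (a b c d : E) :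
    inner ℝ ((10 : ℝ) • a - (15 : ℝ) • b + (6 : ℝ) • c - d) a / 6
      = (‖a‖ ^ 2 + ‖(3 : ℝ) • a - b‖ ^ 2 + ‖(3 : ℝ) • a - (3 : ℝ) • b + c‖ ^ 2) / 12
        - (‖b‖ ^ 2 + ‖(3 : ℝ) • b - c‖ ^ 2 + ‖(3 : ℝ) • b - (3 : ℝ) • c + d‖ ^ 2) / 12
        + ‖a - (3 : ℝ) • b + (3 : ℝ) • c - d‖ ^ 2 / 12 := by
  -- Both sides are quadratic forms in `a, b, c, d`; the coefficients of the inner products agree.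
  simp only [← real_inner_self_eq_norm_sq, inner_add_left, inner_sub_left, inner_add_right,
    inner_sub_right, real_inner_smul_left, real_inner_smul_right]
  rw [real_inner_comm a b, real_inner_comm a c, real_inner_comm a d, real_inner_comm b c,
    real_inner_comm b d, real_inner_comm c d]
  ring

theorem mul_inner_blendedBDF {Δt : ℝ} (hΔt : 0 < Δt) (w : ℕ → X Ω) {n : ℕ} (hn : 2 ≤ n) :
    Δt * inner ℝ (val (blendedBDF Δt w n)) (val (w (n + 1)))
      = energy w (n + 1) - energy w n + (1 / 12) *
        ‖val (w (n + 1) - (3 : ℝ) • w n + (3 : ℝ) • w (n - 1) - w (n - 2))‖ ^ 2 := by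
  have h1 : n + 1 - 2 = n - 1 := by omega
  have key := inner_blended_eq (val (w (n + 1))) (val (w n)) (val (w (n - 1))) (val (w (n - 2)))
  simp only [blendedBDF, energy, extrap, val_add, val_sub, val_smul, Nat.add_sub_cancel, h1,
    real_inner_smul_left]
  have h2 : Δt * (1 / (6 * Δt)) = 1 / 6 := by field_simp
  rw [← mul_assoc, h2]
  linarith

/-- One step of the discrete energy estimate, from its scalar ingredients. -/
theorem energy_step_scalar {ν Δt h K M e e' d g F φ β : ℝ} (hν : 0 < ν) (hΔt : 0 < Δt)
    (hh : 0 < h) (heq : e' - e + (1 / 12) * d ^ 2 + ν * Δt * g ^ 2 = Δt * φ + Δt * β)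
    (hφ : φ ≤ F * g) (hβ : h * β ^ 2 ≤ K * M ^ 2 * g ^ 2 * d ^ 2)
    (hcond : 12 * K * (Δt / (ν * h)) * M ^ 2 ≤ 1) :
    e' + (1 / 24) * d ^ 2 + Δt / 4 * (ν * g ^ 2) ≤ Δt / ν * F ^ 2 + e := by
  -- The viscous term is split as `1/4` for the force, `1/2` for convection and `1/4` kept; half of
  -- `d ^ 2 / 12` is spent on convection.
  have hforce : Δt * φ ≤ Δt / ν * F ^ 2 + Δt / 4 * (ν * g ^ 2) := by
    have h1 : Δt / ν * F ^ 2 + Δt / 4 * (ν * g ^ 2) - Δt * (F * g)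
        = Δt / ν * (F - ν * g / 2) ^ 2 := by
      field_simp
      ring
    have h2 : 0 ≤ Δt / ν * (F - ν * g / 2) ^ 2 := by positivity
    have h3 := mul_le_mul_of_nonneg_left hφ hΔt.le
    linarith
  have hcond' : 12 * K * Δt * M ^ 2 ≤ ν * h := by
    have : 12 * K * (Δt / (ν * h)) * M ^ 2 = 12 * K * Δt * M ^ 2 / (ν * h) := by ring
    rw [this, div_le_one (by positivity)] at hcond
    exact hcond
  have hconv : Δt * β ≤ Δt / 2 * (ν * g ^ 2) + (1 / 24) * d ^ 2 := by
    refine le_of_abs_le (abs_le_of_sq_le_sq ?_ (by positivity))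
    -- The `12` in `hcond` makes the right side `h` times `4 x y`, with `x = Δt ν g² / 2` and `y =
    -- d² / 24`; then `4 x y ≤ (x + y)²`.
    have h1 : h * (Δt * β) ^ 2 ≤ h * (Δt * ν * g ^ 2 * d ^ 2 / 12) := by
      calc h * (Δt * β) ^ 2 = Δt ^ 2 * (h * β ^ 2) := by ring
        _ ≤ Δt ^ 2 * (K * M ^ 2 * g ^ 2 * d ^ 2) := by gcongr
        _ = (12 * K * Δt * M ^ 2) * (Δt * g ^ 2 * d ^ 2 / 12) := by ring
        _ ≤ (ν * h) * (Δt * g ^ 2 * d ^ 2 / 12) := by gcongr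
        _ = _ := by ring
    have h2 := le_of_mul_le_mul_left h1 hh
    linarith [sq_nonneg (Δt / 2 * (ν * g ^ 2) - (1 / 24) * d ^ 2)]
  linarith

end EnsembleNS

theorem theorem2 (Ω : Set Plane) (hΩ : IsOpen Ω) (hΩb : Bornology.IsBounded Ω) (Cinv : ℝ) :
    ∃ C : ℝ, 0 < C ∧
      ∀ (h : ℝ) (Xh : Submodule ℝ (X Ω)) (Qh : Submodule ℝ (L2 ℝ Ω)),
        0 < h → InverseInequality Xh h Cinv → (Qh : Set (L2 ℝ Ω)) ⊆ Q Ω →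
      ∀ (ν Δt : ℝ) (J : ℕ) (f : Fin J → ℕ → X Ω →L[ℝ] ℝ) (N : ℕ)
        (u : Fin J → ℕ → X Ω) (p : Fin J → ℕ → L2 ℝ Ω),
        0 < ν → 0 < Δt → 2 < N → IsDiscreteSolution Xh Qh ν Δt f N u p →
        (∀ n, 2 ≤ n → n < N → ∀ j,
          C * (Δt / (ν * h)) * (normL4 (fluct u j n) + ‖divg (fluct u j n)‖) ^ 2 ≤ 1) →
        ∀ j,
          energy (u j) N
            + (1 / 24) * ∑ n ∈ Finset.Ico 2 N,
                ‖val (u j (n + 1) - (3 : ℝ) • u j n + (3 : ℝ) • u j (n - 1) - u j (n - 2))‖ ^ 2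
            + (Δt / 4) * ∑ n ∈ Finset.Ico 2 N, ν * ‖grad (u j (n + 1))‖ ^ 2
          ≤ ∑ n ∈ Finset.Ico 2 N, (Δt / ν) * dualNorm (f j (n + 1)) ^ 2 + energy (u j) 2 := by
  obtain ⟨K, hK0, hK⟩ := exists_abs_bstar_le hΩb Cinv
  refine ⟨12 * K, by positivity, ?_⟩
  intro h Xh Qh hh hinv _ ν Δt J f N u p hν hΔt hN hsol hcond j
  have hstep : ∀ n, 2 ≤ n → n < N →
      energy (u j) (n + 1)
        + (1 / 24) *
          ‖val (u j (n + 1) - (3 : ℝ) • u j n + (3 : ℝ) • u j (n - 1) - u j (n - 2))‖ ^ 2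
        + Δt / 4 * (ν * ‖grad (u j (n + 1))‖ ^ 2)
      ≤ Δt / ν * dualNorm (f j (n + 1)) ^ 2 + energy (u j) n := by
    intro n hn hnN
    set D := u j (n + 1) - (3 : ℝ) • u j n + (3 : ℝ) • u j (n - 1) - u j (n - 2) with hD
    have hmem : ∀ m ≤ N, u j m ∈ Xh := hsol.velocity_mem j
    -- The inverse inequality will be applied to `D`; at `n = 2` this needs all three starting
    -- values in `Xh`.
    have hDmem : D ∈ Xh :=
      Xh.sub_mem (Xh.add_mem (Xh.sub_mem (hmem _ hnN) (Xh.smul_mem _ (hmem _ hnN.le)))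
        (Xh.smul_mem _ (hmem _ (by omega)))) (hmem _ (by omega))
    have hext : extrap (u j) n = u j (n + 1) - D := by
      rw [hD, extrap]
      abel
    have hmom := hsol.momentum j n hn hnN _ (hmem _ hnN)
    have hp : inner ℝ (p j (n + 1)) (divg (u j (n + 1))) = 0 := by
      rw [real_inner_comm]
      exact hsol.incompressible j n hn hnN _ (hsol.pressure_mem j n hn hnN)
    -- Only `-b*(u', D, u j (n + 1))` survives of the two convective terms.
    rw [bstar_self, hext, bstar_sub_middle, bstar_self, hp, real_inner_self_eq_norm_sq] at hmom
    have hE := mul_inner_blendedBDF hΔt (u j) hn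
    rw [← hD] at hE
    refine energy_step_scalar hν hΔt hh ?_ (apply_le_dualNorm_mul hΩb (f j (n + 1)) _)
      (hK h (fluct u j n) D (u j (n + 1)) hh (hinv D hDmem)) (hcond n hn hnN j)
    rw [← hE, ← hmom]
    ring
  have hsum : ∀ m, 2 ≤ m → m ≤ N →
      energy (u j) m
        + (1 / 24) * ∑ n ∈ Finset.Ico 2 m,
            ‖val (u j (n + 1) - (3 : ℝ) • u j n + (3 : ℝ) • u j (n - 1) - u j (n - 2))‖ ^ 2
        + (Δt / 4) * ∑ n ∈ Finset.Ico 2 m, ν * ‖grad (u j (n + 1))‖ ^ 2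
      ≤ ∑ n ∈ Finset.Ico 2 m, (Δt / ν) * dualNorm (f j (n + 1)) ^ 2 + energy (u j) 2 := by
    intro m hm
    induction m, hm using Nat.le_induction with
    | base => simp
    | succ m hm ih =>
      intro hmN
      rw [Finset.sum_Ico_succ_top hm, Finset.sum_Ico_succ_top hm, Finset.sum_Ico_succ_top hm]
      have h1 := ih (by omega)
      have h2 := hstep m hm (by omega)
      linarith
  exact hsum N hN.le le_rfl
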